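/- Terms of the $\lambda\mu$-calculus (de Groote's syntax, up to renaming of bound variables) are given by $t ::= x \mid \lambda x.t \mid (t\;t) \mid \mu\alpha.t \mid (\alpha\;t)$, with $\lambda$-variables $x$ and $\mu$-variables $\alpha$. Let $\triangleright^*$ be the reflexive transitive closure of the compatible closure of $(\lambda x.u\;v)\triangleright u[x:=v]$ and $(\mu\alpha.u\;v)\triangleright \mu\alpha.u[\alpha:=^*v]$, where $u[\alpha:=^*v]$ is obtained from $u$ by replacing inductively each subterm $(\alpha\;w)$ by $(\alpha\;(w\;v))$. Types are built from propositional variables and $\perp$ with $\to$. The judgement $\Gamma\vdash t:A\,;\,\Delta$, where $\Gamma$ (resp. $\Delta$) is a context declaring types of $\lambda$-variables (resp. $\mu$-variables), is defined by the rules: $\Gamma\vdash x:A;\Delta$ if $(x:A)\in\Gamma$; from $\Gamma,x:A\vdash t:B;\Delta$ infer $\Gamma\vdash\lambda x.t:A\to B;\Delta$; from $\Gamma\vdash u:A\to B;\Delta$ and $\Gamma\vdash v:A;\Delta$ infer $\Gamma\vdash(u\;v):B;\Delta$; from $\Gamma\vdash t:\perp;\Delta,\alpha:A$ infer $\Gamma\vdash\mu\alpha.t:A;\Delta$;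 from $\Gamma\vdash t:A;\Delta,\alpha:A$ infer $\Gamma\vdash(\alpha\;t):\perp;\Delta,\alpha:A$. Let $(x_i)_{i\in\mathbb N}$ be pairwise distinct $\lambda$-variables and $(\alpha_i)_{i\in\mathbb N}$ pairwise distinct $\mu$-variables (not necessarily all the variables), let $(A_i)_{i\in\mathbb N}$ and $(B_i)_{i\in\mathbb N}$ be enumerations of all types (repetitions allowed), and let $(X_i)_{i\in\mathbb N}$ be an enumeration of $\perp$ and all propositional variables with $X_0=\perp$. Put $\mathbb G=\{x_i:A_i \mid i\in\mathbb N\}$ and $\mathbb D=\{\alpha_i:B_i\mid i\in\mathbb N\}$. For a term $u$ all of whose free variables are among the $x_i$ and $\alpha_i$, write $\mathbb G\vdash u:C\,;\,\mathbb D$ if $\mathbb G_u\vdash u:C\,;\,\mathbb D_u$, where $\mathbb G_u,\mathbb D_u$ are the restrictions of $\mathbb G,\mathbb D$ to the free variables of $u$. For an arbitrary term $t$, write $\mathbb G\vdash^* t:C\,;\,\mathbb D$ if there is a term $t'$ with $t\triangleright^*t'$ and $\mathbb G\vdash t':C\,;\,\mathbb D$. Let $\mathbb B_i=\{t \mid \mathbb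 G\vdash^* t:X_i\,;\,\mathbb D\}$, and define a set of terms $\mathbb I(A)$ for every type $A$ by $\mathbb I(X_i)=\mathbb B_i$ for all $i$ (in particular $\mathbb I(\perp)=\mathbb B_0$) and $\mathbb I(A\to B)=\{t \mid (t\;u)\in\mathbb I(B)\text{ for all }u\in\mathbb I(A)\}$. Then for every type $A$ and every term $t$: $\ \mathbb G\vdash^* t:A\,;\,\mathbb D$ if and only if $t\in\mathbb I(A)$. -/

import Mathlib

namespace LambdaMu

universe u v w u' v'

/-- Terms of the `λμ`-calculus (de Groote's syntax), up to renaming of bound variables, whose free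
`λ`-variables are in `V` and whose free `μ`-variables are in `A`. Binders are in nested style: the
body of an abstraction has one more variable, `none`, which is the bound one, and a variable `x` of
the surroundings is `some x` there. -/
inductive Term : Type u → Type v → Type (max (u + 1) (v + 1)) where
  /-- `x` -/
  | var {V : Type u} {A : Type v} (x : V) : Term V A
  /-- `λx.t` -/
  | lam {V : Type u} {A : Type v} (t : Term (Option V) A) : Term V A
  /-- `(t s)` -/
  | app {V : Type u} {A : Type v} (t s : Term V A) : Term V A
  /-- `μα.t` -/
  | mu {V : Type u} {A : Type v} (t : Term V (Option A)) : Term V A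
  /-- `(α t)` -/
  | named {V : Type u} {A : Type v} (a : A) (t : Term V A) : Term V A

namespace Term

/-- Renaming of the free variables. -/
def rename : {V : Type u} → {A : Type v} → {W : Type u'} → {B : Type v'} →
    (V → W) → (A → B) → Term V A → Term W B
  | _, _, _, _, f, _, var x => var (f x)
  | _, _, _, _, f, g, lam t => lam (rename (Option.map f) g t)
  | _, _, _, _, f, g, app t s => app (rename f g t) (rename f g s)
  | _, _, _, _, f, g, mu t => mu (rename f (Option.map g) t)
  | _, _, _, _, f, g, named a t => named (g a) (rename f g t)

/-- A term seen below a new `λ`-binder. -/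
def weakenLam {V : Type u} {A : Type v} (t : Term V A) : Term (Option V) A := rename some id t

/-- A term seen below a new `μ`-binder. -/
def weakenMu {V : Type u} {A : Type v} (t : Term V A) : Term V (Option A) := rename id some t

/-- Simultaneous capture-avoiding substitution of terms for the free `λ`-variables. -/
def subst : {V : Type u} → {A : Type v} → {W : Type u'} →
    (V → Term W A) → Term V A → Term W A
  | _, _, _, σ, var x => σ x
  | _, _, _, σ, lam t =>
      lam (subst (fun x => Option.elim x (var none) fun y => (σ y).weakenLam) t)
  | _, _, _, σ, app t s => app (subst σ t) (subst σ s)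
  | _, _, _, σ, mu t => mu (subst (fun x => (σ x).weakenMu) t)
  | _, _, _, σ, named a t => named a (subst σ t)

/-- `t[x := v]`, where `x` is the variable `none` of `t`. -/
def inst {V : Type u} {A : Type v} (t : Term (Option V) A) (v : Term V A) : Term V A :=
  subst (fun x => Option.elim x v var) t

open Classical in
/-- `t[α :=* v]`: each subterm `(α w)` of `t` is replaced, inductively, by `(α (w v))`. -/
noncomputable def substMu : {V : Type u} → {A : Type v} → A → Term V A → Term V A → Term V A
  | _, _, _, _, var x => var x
  | _, _, α, v, lam t => lam (substMu α v.weakenLam t)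
  | _, _, α, v, app t s => app (substMu α v t) (substMu α v s)
  | _, _, α, v, mu t => mu (substMu (some α) v.weakenMu t)
  | _, _, α, v, named β t =>
      if β = α then named β (app (substMu α v t) v) else named β (substMu α v t)

/-- The free `λ`-variables. -/
def freeLam : {V : Type u} → {A : Type v} → Term V A → Set V
  | _, _, var x => {x}
  | _, _, lam t => {x | some x ∈ freeLam t}
  | _, _, app t s => freeLam t ∪ freeLam s
  | _, _, mu t => freeLam t
  | _, _, named _ t => freeLam t

/-- The free `μ`-variables. -/
def freeMu : {V : Type u} → {A : Type v} → Term V A → Set A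
  | _, _, var _ => ∅
  | _, _, lam t => freeMu t
  | _, _, app t s => freeMu t ∪ freeMu s
  | _, _, mu t => {a | some a ∈ freeMu t}
  | _, _, named a t => {a} ∪ freeMu t

/-- One-step reduction `t ▷ t'`: the compatible closure of the two basic rules. -/
inductive Red : {V : Type u} → {A : Type v} → Term V A → Term V A → Prop where
  /-- `(λx.t s) ▷ t[x := s]` -/
  | beta {V : Type u} {A : Type v} (t : Term (Option V) A) (s : Term V A) :
      Red (app (lam t) s) (t.inst s)
  /-- `(μα.t s) ▷ μα.t[α :=* s]` -/
  | mu {V : Type u} {A : Type v} (t : Term V (Option A)) (s : Term V A) :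
      Red (app (Term.mu t) s) (Term.mu (substMu none s.weakenMu t))
  | lamCongr {V : Type u} {A : Type v} {t t' : Term (Option V) A} :
      Red t t' → Red (lam t) (lam t')
  | appLeft {V : Type u} {A : Type v} {t t' : Term V A} (s : Term V A) :
      Red t t' → Red (app t s) (app t' s)
  | appRight {V : Type u} {A : Type v} (t : Term V A) {s s' : Term V A} :
      Red s s' → Red (app t s) (app t s')
  | muCongr {V : Type u} {A : Type v} {t t' : Term V (Option A)} :
      Red t t' → Red (Term.mu t) (Term.mu t')
  | namedCongr {V : Type u} {A : Type v} (a : A) {t t' : Term V A} :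
      Red t t' → Red (named a t) (named a t')

/-- `t ▷* t'`. -/
def Reds {V : Type u} {A : Type v} (t t' : Term V A) : Prop := Relation.ReflTransGen Red t t'

end Term

/-- Types: propositional formulas over the propositional variables in `P`. -/
inductive Ty (P : Type w) : Type w where
  | var (p : P) : Ty P
  | bot : Ty P
  | arrow (S T : Ty P) : Ty P

/-- A context declares at most one type for each variable. -/
abbrev Ctx (V : Type u) (P : Type w) : Type (max u w) := V → Option (Ty P)

/-- The context `Γ, x : S` for the new variable `x = none`. -/
def Ctx.cons {V : Type u} {P : Type w} (S : Ty P) (Γ : Ctx V P) : Ctx (Option V) P :=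
  fun x => Option.elim x (some S) Γ

open Classical in
/-- The declarations of `Γ` for the variables in `s`. -/
noncomputable def Ctx.restrict {V : Type u} {P : Type w} (Γ : Ctx V P) (s : Set V) : Ctx V P :=
  fun x => if x ∈ s then Γ x else none

/-- `Γ ⊢ t : T ; Δ` -/
inductive Typed {P : Type w} : {V : Type u} → {A : Type v} →
    Ctx V P → Term V A → Ty P → Ctx A P → Prop where
  | ax {V : Type u} {A : Type v} {Γ : Ctx V P} {Δ : Ctx A P} {x : V} {T : Ty P} :
      Γ x = some T → Typed Γ (.var x) T Δ
  | arrowIntro {V : Type u} {A : Type v} {Γ : Ctx V P} {Δ : Ctx A P}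
      {t : Term (Option V) A} {S T : Ty P} :
      Typed (Γ.cons S) t T Δ → Typed Γ (.lam t) (.arrow S T) Δ
  | arrowElim {V : Type u} {A : Type v} {Γ : Ctx V P} {Δ : Ctx A P} {t s : Term V A} {S T : Ty P} :
      Typed Γ t (.arrow S T) Δ → Typed Γ s S Δ → Typed Γ (.app t s) T Δ
  | mu {V : Type u} {A : Type v} {Γ : Ctx V P} {Δ : Ctx A P} {t : Term V (Option A)} {T : Ty P} :
      Typed Γ t .bot (Δ.cons T) → Typed Γ (.mu t) T Δ
  | named {V : Type u} {A : Type v} {Γ : Ctx V P} {Δ : Ctx A P} {a : A} {t : Term V A} {T : Ty P} :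
      Δ a = some T → Typed Γ t T Δ → Typed Γ (.named a t) .bot Δ

/-- `K ⇝ L` for sets of terms. -/
def funSpace {V : Type u} {A : Type v} (K L : Set (Term V A)) : Set (Term V A) :=
  {t | ∀ s ∈ K, t.app s ∈ L}

/-- The extension to all types of an assignment `I` of sets of terms to the propositional
variables, with `⊥` interpreted by `B₀`. -/
def interp {V : Type u} {A : Type v} {P : Type w} (B₀ : Set (Term V A))
    (I : P → Set (Term V A)) : Ty P → Set (Term V A)
  | .var p => I p
  | .bot => B₀
  | .arrow S T => funSpace (interp B₀ I S) (interp B₀ I T)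

/-- The parameters of the completeness model: enumerations (without repetition) of an infinite set
of `λ`-variables and of an infinite set of `μ`-variables, two enumerations of all types, and an
enumeration, beginning with `⊥`, of `⊥` and the propositional variables. -/
structure Enumerations (V : Type u) (A : Type v) (P : Type w) where
  /-- `x_i` -/
  lamVar : ℕ → V
  lamVar_injective : Function.Injective lamVar
  /-- `α_i` -/
  muVar : ℕ → A
  muVar_injective : Function.Injective muVar
  /-- `A_i` -/
  lamTy : ℕ → Ty P
  lamTy_surjective : Function.Surjective lamTy
  /-- `B_i` -/
  muTy : ℕ → Ty P
  muTy_surjective : Function.Surjective muTy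
  /-- `X_i` -/
  atom : ℕ → Ty P
  range_atom : Set.range atom = {Ty.bot} ∪ Set.range Ty.var
  atom_zero : atom 0 = Ty.bot

namespace Enumerations

variable {V : Type u} {A : Type v} {P : Type w} (E : Enumerations V A P)

/-- The infinite context `𝔾 = {x_i : A_i}`. -/
noncomputable def G : Ctx V P := Function.extend E.lamVar (fun i => some (E.lamTy i)) fun _ => none

/-- The infinite context `𝔻 = {α_i : B_i}`. -/
noncomputable def D : Ctx A P := Function.extend E.muVar (fun i => some (E.muTy i)) fun _ => none

/-- `𝔾 ⊢ t : T ; 𝔻`, for a term whose free variables are all among the `x_i` and the `α_i`: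
typability in the finite contexts that declare just the free variables of `t`. -/
def Types (t : Term V A) (T : Ty P) : Prop :=
  (t.freeLam ⊆ Set.range E.lamVar ∧ t.freeMu ⊆ Set.range E.muVar) ∧
    Typed (E.G.restrict t.freeLam) t T (E.D.restrict t.freeMu)

/-- `𝔾 ⊢* t : T ; 𝔻` -/
def TypesStar (t : Term V A) (T : Ty P) : Prop := ∃ t', t.Reds t' ∧ E.Types t' T

/-- `𝔹_i` -/
def bottom (i : ℕ) : Set (Term V A) := {t | E.TypesStar t (E.atom i)}

end Enumerations

end LambdaMu

namespace LambdaMu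

universe u v w u' v' u'' v''

/-! ### Renaming and substitution -/

namespace Term

/-! Induction on the type. The atomic cases hold by the choice of the interpretation, and the arrow
case is `typesStar_arrow_iff`, whose hard half tests `t` on a variable `x_i` with `A_i` equal to the
domain `U`. It must turn a typed reduct of `(t x_i)` into a reduct of `t` of type `U → T`. The
relation `Applied` follows `x_i` through the reduction. A step of the applied term either is already
available in `t`, which copies it, or contracts a redex created by passing `x_i`, and then `t` stays
put (`Applied.red`). At the end, typing is pulled back from the applied term to `t`
(`Applied.typed`). Neither subject reduction nor confluence is used, and `x_i` need not be fresh for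
`t`. -/

theorem rename_rename {V : Type u} {A : Type v} (t : Term V A) :
    ∀ {W : Type u'} {B : Type v'} {W' : Type u''} {B' : Type v''} (f : V → W) (g : A → B)
      (f' : W → W') (g' : B → B'),
      rename f' g' (rename f g t) = rename (f' ∘ f) (g' ∘ g) t := by
  induction t with
  | var x => intros; rfl
  | lam t ih => intros; simp only [rename, ih, Option.map_comp_map]
  | app t s iht ihs => intros; simp only [rename, iht, ihs]
  | mu t ih => intros; simp only [rename, ih, Option.map_comp_map]
  | named a t ih => intros; simp only [rename, ih, Function.comp]

theorem rename_id {V : Type u} {A : Type v} (t : Term V A) : rename id id t = t := by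
  induction t with
  | var x => rfl
  | lam t ih => simp only [rename, Option.map_id, ih]
  | app t s iht ihs => simp only [rename, iht, ihs]
  | mu t ih => simp only [rename, Option.map_id, ih]
  | named a t ih => simp only [rename, ih, id]

theorem rename_weakenLam {V : Type u} {A : Type v} {W : Type u'} {B : Type v'} (f : V → W)
    (g : A → B) (t : Term V A) :
    rename (Option.map f) g t.weakenLam = (rename f g t).weakenLam := by
  simp only [weakenLam, rename_rename]; rfl

theorem rename_weakenMu {V : Type u} {A : Type v} {W : Type u'} {B : Type v'} (f : V → W)
    (g : A → B) (t : Term V A) :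
    rename f (Option.map g) t.weakenMu = (rename f g t).weakenMu := by
  simp only [weakenMu, rename_rename]; rfl

theorem rename_elim_weakenLam {V : Type u} {A : Type v} (x : V) (t : Term V A) :
    rename (fun y => Option.elim y x id) id t.weakenLam = t := by
  rw [weakenLam, rename_rename]
  exact rename_id t

theorem rename_subst {V : Type u} {A : Type v} (t : Term V A) :
    ∀ {W : Type u} {V' : Type u'} {W' : Type u'} {B : Type v'} (f : V → V') (f' : W → W')
      (g : A → B) (σ : V → Term W A) (τ : V' → Term W' B),
      (∀ y, rename f' g (σ y) = τ (f y)) →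
        rename f' g (subst σ t) = subst τ (rename f g t) := by
  induction t with
  | var x => intro _ _ _ _ f f' g σ τ h; exact h x
  | lam t ih =>
    intro _ _ _ _ f f' g σ τ h
    simp only [rename, subst]
    refine congrArg lam (ih _ _ _ _ _ ?_)
    rintro (_ | y)
    · rfl
    · simp only [Option.elim, Option.map, ← h]
      exact rename_weakenLam _ _ _
  | app t s iht ihs =>
    intro _ _ _ _ f f' g σ τ h
    simp only [rename, subst, iht _ _ _ _ _ h, ihs _ _ _ _ _ h]
  | mu t ih =>
    intro _ _ _ _ f f' g σ τ h
    simp only [rename, subst]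
    refine congrArg mu (ih _ _ _ _ _ fun y => ?_)
    rw [← h, rename_weakenMu]
  | named a t ih =>
    intro _ _ _ _ f f' g σ τ h
    simp only [rename, subst, ih _ _ _ _ _ h]

theorem rename_inst {V : Type u} {A : Type v} {W : Type u'} {B : Type v'} (f : V → W) (g : A → B)
    (t : Term (Option V) A) (s : Term V A) :
    rename f g (t.inst s) = (rename (Option.map f) g t).inst (rename f g s) := by
  refine rename_subst t _ _ _ _ _ ?_
  rintro (_ | y) <;> rfl

theorem subst_eq_rename {V : Type u} {A : Type v} (t : Term V A) :
    ∀ {W : Type u} (f : V → W) (σ : V → Term W A), (∀ y, σ y = var (f y)) →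
      subst σ t = rename f id t := by
  induction t with
  | var x => intro _ f σ h; exact h x
  | lam t ih =>
    intro _ f σ h
    simp only [rename, subst]
    refine congrArg lam (ih _ _ ?_)
    rintro (_ | y)
    · rfl
    · simp only [Option.elim, h]; rfl
  | app t s iht ihs =>
    intro _ f σ h
    simp only [rename, subst, iht _ _ h, ihs _ _ h]
  | mu t ih =>
    intro _ f σ h
    simp only [rename, subst, Option.map_id]
    refine congrArg mu (ih _ _ fun y => ?_)
    rw [h]; rfl
  | named a t ih =>
    intro _ f σ h
    simp only [rename, subst, ih _ _ h, id]

theorem inst_var {V : Type u} {A : Type v} (t : Term (Option V) A) (x : V) :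
    t.inst (var x) = rename (fun y => Option.elim y x id) id t :=
  subst_eq_rename t _ _ (by rintro (_ | y) <;> rfl)

/-- Injectivity on `μ`-variables matters because `substMu` compares names: identifying two names
would send the argument to additional subterms. -/
theorem rename_substMu {V : Type u} {A : Type v} (t : Term V A) :
    ∀ {W : Type u'} {B : Type v'} (f : V → W) (g : A → B) (_ : Function.Injective g) (a : A)
      (s : Term V A),
      rename f g (substMu a s t) = substMu (g a) (rename f g s) (rename f g t) := by
  induction t with
  | var x => intros; rfl
  | lam t ih =>
    intro _ _ f g hg a s
    simp only [rename, substMu, ih _ _ hg, rename_weakenLam]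
  | app t s iht ihs =>
    intro _ _ f g hg a s
    simp only [rename, substMu, iht _ _ hg, ihs _ _ hg]
  | mu t ih =>
    intro _ _ f g hg a s
    simp only [rename, substMu, ih _ _ (Option.map_injective hg), rename_weakenMu, Option.map_some]
  | named b t ih =>
    intro _ _ f g hg a s
    by_cases h : b = a
    · simp only [rename, substMu, h, if_true, ih _ _ hg]
    · simp only [rename, substMu, h, hg.eq_iff, if_false, ih _ _ hg]

/-- Putting variables for variables creates no redex, so `f` may even identify `λ`-variables. -/
theorem Red.of_rename {V : Type u} {A : Type v} (t : Term V A) :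
    ∀ {W : Type u'} {B : Type v'} (f : V → W) (g : A → B) (_ : Function.Injective g)
      {r : Term W B}, Red (rename f g t) r → ∃ t', Red t t' ∧ r = rename f g t' := by
  induction t with
  | var x => intro _ _ f g _ r h; cases h
  | lam t ih =>
    intro _ _ f g hg r h
    cases h with
    | lamCongr h =>
      obtain ⟨t', h', rfl⟩ := ih _ _ hg h
      exact ⟨_, .lamCongr h', rfl⟩
  | app t s iht ihs =>
    intro _ _ f g hg r h
    rw [rename] at h
    generalize ht : rename f g t = t₀ at h
    generalize hs : rename f g s = s₀ at h
    cases h with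
    | beta t₁ =>
      cases t <;> simp only [rename, reduceCtorEq, lam.injEq] at ht
      subst ht hs
      exact ⟨_, .beta _ _, (rename_inst _ _ _ _).symm⟩
    | mu t₁ =>
      cases t <;> simp only [rename, reduceCtorEq, mu.injEq] at ht
      subst ht hs
      refine ⟨_, .mu _ _, ?_⟩
      rw [rename, rename_substMu _ _ _ (Option.map_injective hg), rename_weakenMu]; rfl
    | appLeft _ h =>
      subst ht hs
      obtain ⟨t', h', rfl⟩ := iht _ _ hg h
      exact ⟨_, .appLeft _ h', rfl⟩
    | appRight _ h =>
      subst ht hs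
      obtain ⟨t', h', rfl⟩ := ihs _ _ hg h
      exact ⟨_, .appRight _ h', rfl⟩
  | mu t ih =>
    intro _ _ f g hg r h
    cases h with
    | muCongr h =>
      obtain ⟨t', h', rfl⟩ := ih _ _ (Option.map_injective hg) h
      exact ⟨_, .muCongr h', rfl⟩
  | named a t ih =>
    intro _ _ f g hg r h
    cases h with
    | namedCongr _ h =>
      obtain ⟨t', h', rfl⟩ := ih _ _ hg h
      exact ⟨_, .namedCongr _ h', rfl⟩

/-! ### Compatibility of `▷*` with the term constructors -/

section Reds

variable {V : Type u} {A : Type v}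

theorem Reds.lam {t t' : Term (Option V) A} (h : t.Reds t') : (lam t).Reds (lam t') :=
  Relation.ReflTransGen.lift Term.lam (fun _ _ => Red.lamCongr) _ _ h

theorem Reds.mu {t t' : Term V (Option A)} (h : t.Reds t') : (mu t).Reds (mu t') :=
  Relation.ReflTransGen.lift Term.mu (fun _ _ => Red.muCongr) _ _ h

theorem Reds.named (a : A) {t t' : Term V A} (h : t.Reds t') : (named a t).Reds (named a t') :=
  Relation.ReflTransGen.lift (Term.named a) (fun _ _ => Red.namedCongr a) _ _ h

theorem Reds.app {t t' s s' : Term V A} (ht : t.Reds t') (hs : s.Reds s') :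
    (app t s).Reds (app t' s') :=
  (Relation.ReflTransGen.lift (fun r => Term.app r s) (fun _ _ => Red.appLeft s) _ _ ht).trans
    (Relation.ReflTransGen.lift (Term.app t') (fun _ _ => Red.appRight t') _ _ hs)

end Reds

/-! ### Tracking a variable argument through reduction -/

/-- `Applied b S x t s`: the term `s` comes from `t` by giving the argument `x` to each subterm
named by a `μ`-variable in `S` (and to `t` itself if `b` holds), and then contracting some of the
redexes that these new applications create. -/
inductive Applied : {V : Type u} → {A : Type v} → Bool → (A → Bool) → V →
    Term V A → Term V A → Prop where
  | var {V : Type u} {A : Type v} {S : A → Bool} {x : V} (y : V) :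
      Applied false S x (var y) (var y)
  | lam {V : Type u} {A : Type v} {S : A → Bool} {x : V} {t s : Term (Option V) A} :
      Applied false S (some x) t s → Applied false S x (lam t) (lam s)
  | app {V : Type u} {A : Type v} {S : A → Bool} {x : V} {t s t' s' : Term V A} :
      Applied false S x t s → Applied false S x t' s' →
        Applied false S x (app t t') (app s s')
  | mu {V : Type u} {A : Type v} {b : Bool} {S : A → Bool} {x : V} {t s : Term V (Option A)} :
      -- If `b` holds, the redex `(μα.t x)` has been contracted, so the bound name joins the set of
      -- names that receive `x`.
      Applied false (fun a => Option.elim a b S) x t s → Applied b S x (mu t) (mu s)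
  | named {V : Type u} {A : Type v} {S : A → Bool} {x : V} (a : A) {t s : Term V A} :
      Applied (S a) S x t s → Applied false S x (named a t) (named a s)
  | arg {V : Type u} {A : Type v} {S : A → Bool} {x : V} {t s : Term V A} :
      Applied false S x t s → Applied true S x t (Term.app s (Term.var x))
  | beta {V : Type u} {A : Type v} {S : A → Bool} {x : V} {t s : Term (Option V) A}
      {r : Term V A} :
      Applied false S (some x) t s → r = rename (fun y => Option.elim y x id) id s →
        Applied true S x (Term.lam t) r

namespace Applied

theorem refl {V : Type u} {A : Type v} (t : Term V A) :
    ∀ (S : A → Bool) (x : V), (∀ a, S a = false) → Applied false S x t t := by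
  induction t with
  | var y => intros; exact .var y
  | lam t ih => intro S x h; exact .lam (ih _ _ h)
  | app t s iht ihs => intro S x h; exact .app (iht _ _ h) (ihs _ _ h)
  | mu t ih =>
    intro S x h
    refine .mu (ih _ _ ?_)
    rintro (_ | a)
    · rfl
    · exact h a
  | named a t ih =>
    intro S x h
    refine .named a ?_
    rw [h]
    exact ih _ _ h

theorem rename {V : Type u} {A : Type v} {b : Bool} {S : A → Bool} {x : V} {t s : Term V A}
    (h : Applied b S x t s) :
    ∀ {W : Type u} {B : Type v} (S' : B → Bool) (f : V → W) (g : A → B), (∀ a, S' (g a) = S a) →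
      Applied b S' (f x) (t.rename f g) (s.rename f g) := by
  induction h with
  | var y => intros; exact .var _
  | lam _ ih => intro _ _ S' f g h; exact .lam (ih S' (Option.map f) g h)
  | app _ _ iht ihs => intro _ _ S' f g h; exact .app (iht _ _ _ h) (ihs _ _ _ h)
  | mu _ ih =>
    intro _ _ S' f g h
    refine .mu (ih _ _ _ ?_)
    rintro (_ | a)
    · rfl
    · exact h a
  | named a _ ih =>
    intro _ _ S' f g h
    refine .named _ ?_
    rw [h]
    exact ih _ _ _ h
  | arg _ ih => intro _ _ S' f g h; exact .arg (ih _ _ _ h)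
  | beta _ hr ih =>
    intro _ _ S' f g h
    refine .beta (ih S' (Option.map f) g h) ?_
    rw [hr, rename_rename, rename_rename]
    congr 1
    funext y
    cases y <;> rfl

/-- The condition on `τ x` keeps the tracked argument a variable. -/
theorem subst {V : Type u} {A : Type v} {b : Bool} {S : A → Bool} {x : V} {t s : Term V A}
    (h : Applied b S x t s) :
    ∀ {W : Type u} (x' : W) (σ τ : V → Term W A), (∀ y, Applied false S x' (σ y) (τ y)) →
      τ x = Term.var x' → Applied b S x' (t.subst σ) (s.subst τ) := by
  induction h with
  | var y => intro _ x' σ τ h _; exact h y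
  | lam _ ih =>
    intro _ x' σ τ h hx
    refine .lam (ih _ _ _ ?_ ?_)
    · rintro (_ | y)
      · exact .var _
      · exact (h y).rename _ some id fun _ => rfl
    · simp only [Option.elim, hx]; rfl
  | app _ _ iht ihs => intro _ x' σ τ h hx; exact .app (iht _ _ _ h hx) (ihs _ _ _ h hx)
  | mu _ ih =>
    intro _ x' σ τ h hx
    refine .mu (ih _ _ _ (fun y => (h y).rename _ id some fun _ => rfl) ?_)
    rw [hx]; rfl
  | named a _ ih => intro _ x' σ τ h hx; exact .named _ (ih _ _ _ h hx)
  | arg _ ih =>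
    intro _ x' σ τ h hx
    simp only [Term.subst, hx]
    exact .arg (ih _ _ _ h hx)
  | beta _ hr ih =>
    intro _ x' σ τ h hx
    refine .beta (ih (some x') _ (fun y => Option.elim y (Term.var none) fun y =>
      (τ y).weakenLam) ?_ ?_) ?_
    · rintro (_ | y)
      · exact .var _
      · exact (h y).rename _ some id fun _ => rfl
    · simp only [Option.elim, hx]; rfl
    · rw [hr]
      refine (rename_subst _ _ _ _ _ _ ?_).symm
      rintro (_ | y)
      · exact hx.symm
      · exact rename_elim_weakenLam _ _

theorem inst {V : Type u} {A : Type v} {S : A → Bool} {x : V} {t s : Term (Option V) A}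
    {t' s' : Term V A} (h : Applied false S (some x) t s) (h' : Applied false S x t' s') :
    Applied false S x (t.inst t') (s.inst s') := by
  refine h.subst _ _ _ ?_ rfl
  rintro (_ | y)
  · exact h'
  · exact .var y

/-- With `S a = false`, subterms named `a` receive only `t'` and `s'`. Otherwise `x` would come
first on one side only, and the relation would break. -/
theorem substMu {V : Type u} {A : Type v} {b : Bool} {S : A → Bool} {x : V} {t s : Term V A}
    (h : Applied b S x t s) :
    ∀ (a : A) {t' s' : Term V A}, S a = false → Applied false S x t' s' →
      Applied b S x (Term.substMu a t' t) (Term.substMu a s' s) := by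
  induction h with
  | var y => intros; exact .var y
  | lam _ ih => intro a _ _ ha h; exact .lam (ih a ha (h.rename _ some id fun _ => rfl))
  | app _ _ iht ihs => intro a _ _ ha h; exact .app (iht a ha h) (ihs a ha h)
  | mu _ ih => intro a _ _ ha h; exact .mu (ih (some a) ha (h.rename _ id some fun _ => rfl))
  | @named _ _ S _ c _ _ _ ih =>
    intro a _ _ ha h
    have ih := ih a ha h
    by_cases hc : c = a
    · subst hc
      simp only [Term.substMu, if_true]
      refine .named _ ?_
      rw [ha] at ih ⊢
      exact .app ih h
    · simp only [Term.substMu, hc, if_false]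
      exact .named _ ih
  | arg _ ih => intro a _ _ ha h; exact .arg (ih a ha h)
  | beta _ hr ih =>
    intro a _ s' ha h
    refine .beta (ih a ha (h.rename _ some id fun _ => rfl)) ?_
    rw [hr, rename_substMu _ _ _ Function.injective_id]
    exact congrArg (fun r => Term.substMu a r _) (rename_elim_weakenLam _ s').symm

/-- The effect of contracting a created `μ`-redex: `a` is added to the names whose subterms receive
`x`. -/
theorem substMu_var {V : Type u} {A : Type v} {b : Bool} {S : A → Bool} {x : V} {t s : Term V A}
    (h : Applied b S x t s) :
    ∀ (a : A) (S' : A → Bool), S a = false → S' a = true → (∀ c, c ≠ a → S' c = S c) →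
      Applied b S' x t (Term.substMu a (Term.var x) s) := by
  induction h with
  | var y => intros; exact .var y
  | lam _ ih => intro a S' h₀ h₁ h; exact .lam (ih a S' h₀ h₁ h)
  | app _ _ iht ihs => intro a S' h₀ h₁ h; exact .app (iht a S' h₀ h₁ h) (ihs a S' h₀ h₁ h)
  | mu _ ih =>
    intro a S' h₀ h₁ h
    refine .mu (ih (some a) _ h₀ h₁ ?_)
    rintro (_ | c) hc
    · rfl
    · exact h c fun e => hc (congrArg some e)
  | named c _ ih =>
    intro a S' h₀ h₁ h
    have ih := ih a S' h₀ h₁ h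
    by_cases hc : c = a
    · subst hc
      simp only [Term.substMu, if_true]
      refine .named _ ?_
      rw [h₀] at ih
      rw [h₁]
      exact .arg ih
    · simp only [Term.substMu, hc, if_false]
      refine .named _ ?_
      rw [h c hc]
      exact ih
  | arg _ ih => intro a S' h₀ h₁ h; exact .arg (ih a S' h₀ h₁ h)
  | beta _ hr ih =>
    intro a S' h₀ h₁ h
    refine .beta (ih a S' h₀ h₁ h) ?_
    rw [hr, rename_substMu _ _ _ Function.injective_id]
    rfl

/-- Old redexes of `s` have counterparts in `t`; contracting a created one changes only how `s`
arises from the same `t`. -/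
theorem red {V : Type u} {A : Type v} {b : Bool} {S : A → Bool} {x : V} {t s : Term V A}
    (h : Applied b S x t s) :
    ∀ {s' : Term V A}, Red s s' → ∃ t', t.Reds t' ∧ Applied b S x t' s' := by
  induction h with
  | var y => intro _ hs; cases hs
  | lam _ ih =>
    intro _ hs
    cases hs with
    | lamCongr hs =>
      obtain ⟨t', ht, h'⟩ := ih hs
      exact ⟨_, ht.lam, .lam h'⟩
  | app h₁ h₂ ih₁ ih₂ =>
    intro _ hs
    cases hs with
    | beta s₀ =>
      cases h₁ with
      | lam h₀ => exact ⟨_, .single (.beta _ _), h₀.inst h₂⟩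
    | mu s₀ =>
      cases h₁ with
      | mu h₀ =>
        exact ⟨_, .single (.mu _ _), .mu (h₀.substMu none rfl (h₂.rename _ id some fun _ => rfl))⟩
    | appLeft _ hs =>
      obtain ⟨t', ht, h'⟩ := ih₁ hs
      exact ⟨_, ht.app .refl, .app h' h₂⟩
    | appRight _ hs =>
      obtain ⟨t', ht, h'⟩ := ih₂ hs
      exact ⟨_, Reds.app .refl ht, .app h₁ h'⟩
  | mu _ ih =>
    intro _ hs
    cases hs with
    | muCongr hs =>
      obtain ⟨t', ht, h'⟩ := ih hs
      exact ⟨_, ht.mu, .mu h'⟩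
  | named a _ ih =>
    intro _ hs
    cases hs with
    | namedCongr _ hs =>
      obtain ⟨t', ht, h'⟩ := ih hs
      exact ⟨_, ht.named a, .named a h'⟩
  | arg h ih =>
    intro _ hs
    cases hs with
    | beta s₀ =>
      cases h with
      -- A created `β`-redex: `t` does not move, and `arg` is replaced by `beta`.
      | lam h₀ => exact ⟨_, .refl, .beta h₀ (inst_var _ _)⟩
    | mu s₀ =>
      cases h with
      | mu h₀ =>
        refine ⟨_, .refl, .mu (h₀.substMu_var none _ rfl rfl ?_)⟩
        rintro (_ | c) hc
        · exact absurd rfl hc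
        · rfl
    | appLeft _ hs =>
      obtain ⟨t', ht, h'⟩ := ih hs
      exact ⟨_, ht, .arg h'⟩
    | appRight _ hs => cases hs
  | beta _ hr ih =>
    intro _ hs
    rw [hr] at hs
    -- The step lifts to the body before its bound variable was identified with `x`, so `t` can copy
    -- it under the `λ`.
    obtain ⟨s₁, hs₁, rfl⟩ := hs.of_rename _ _ _ Function.injective_id
    obtain ⟨t', ht, h'⟩ := ih hs₁
    exact ⟨_, ht.lam, .beta h' rfl⟩

theorem reds {V : Type u} {A : Type v} {b : Bool} {S : A → Bool} {x : V} {t s s' : Term V A}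
    (h : Applied b S x t s) (hs : s.Reds s') : ∃ t', t.Reds t' ∧ Applied b S x t' s' := by
  induction hs with
  | refl => exact ⟨t, .refl, h⟩
  | tail _ hs ih =>
    obtain ⟨t₁, ht₁, h₁⟩ := ih
    obtain ⟨t₂, ht₂, h₂⟩ := h₁.red hs
    exact ⟨t₂, ht₁.trans ht₂, h₂⟩

end Applied

end Term

/-! ### Typing pulled back along renaming and application -/

section Typing

variable {P : Type w}

theorem Typed.of_rename {V : Type u} {A : Type v} (t : Term V A) :
    ∀ {W : Type u'} {B : Type v'} (f : V → W) (g : A → B) {Γ : Ctx W P} {Δ : Ctx B P}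
      {T : Ty P}, Typed Γ (t.rename f g) T Δ → Typed (Γ ∘ f) t T (Δ ∘ g) := by
  induction t with
  | var x =>
    intro _ _ f g Γ Δ T h
    cases h with
    | ax h => exact .ax h
  | lam t ih =>
    intro _ _ f g Γ Δ T h
    cases h with
    | arrowIntro h =>
      refine .arrowIntro ?_
      convert ih _ _ h using 1
      funext y
      cases y <;> rfl
  | app t s iht ihs =>
    intro _ _ f g Γ Δ T h
    cases h with
    | arrowElim h h' => exact .arrowElim (iht _ _ h) (ihs _ _ h')
  | mu t ih =>
    intro _ _ f g Γ Δ T h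
    cases h with
    | mu h =>
      refine .mu ?_
      convert ih _ _ h using 1
      funext y
      cases y <;> rfl
  | named a t ih =>
    intro _ _ f g Γ Δ T h
    cases h with
    | named ha h => exact .named ha (ih _ _ h)

/-- Each place that received `x : U` loses this argument in `t`, so its type `T` becomes `U → T`;
names in `S` are redeclared accordingly. -/
theorem Term.Applied.typed {V : Type u} {A : Type v} {b : Bool} {S : A → Bool} {x : V}
    {t s : Term V A} (h : Applied b S x t s) :
    ∀ {Γ : Ctx V P} {Δ Δ' : Ctx A P} {U T : Ty P}, Γ x = some U →
      (∀ a, Δ' a = (Δ a).map fun T => if S a then .arrow U T else T) → Typed Γ s T Δ →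
        Typed Γ t (if b then .arrow U T else T) Δ' := by
  induction h with
  | var y =>
    intro Γ Δ Δ' U T hx hΔ h
    cases h with
    | ax h => exact .ax h
  | lam _ ih =>
    intro Γ Δ Δ' U T hx hΔ h
    cases h with
    | arrowIntro h => exact .arrowIntro (ih hx hΔ h)
  | app _ _ iht ihs =>
    intro Γ Δ Δ' U T hx hΔ h
    cases h with
    | arrowElim h h' => exact .arrowElim (iht hx hΔ h) (ihs hx hΔ h')
  | mu _ ih =>
    intro Γ Δ Δ' U T hx hΔ h
    cases h with
    | mu h =>
      refine .mu (ih hx ?_ h)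
      rintro (_ | a)
      · rfl
      · exact hΔ a
  | named a _ ih =>
    intro Γ Δ Δ' U T hx hΔ h
    cases h with
    | named ha h =>
      refine .named ?_ (ih hx hΔ h)
      rw [hΔ, ha]; rfl
  | arg _ ih =>
    intro Γ Δ Δ' U T hx hΔ h
    cases h with
    | arrowElim h h' =>
      cases h' with
      | ax h' =>
        obtain rfl := Option.some.inj (hx.symm.trans h')
        exact ih hx hΔ h
  | beta _ hr ih =>
    intro Γ Δ Δ' U T hx hΔ h
    rw [hr] at h
    refine .arrowIntro (ih (Γ := Γ.cons U) hx hΔ ?_)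
    -- The bound variable was renamed to `x`, so it inherits the type `U` of `x`.
    convert Typed.of_rename _ _ _ h using 1
    · funext y
      cases y
      · exact hx.symm
      · rfl
    · rfl

/-- If `(t x)` reduces to a term of type `T`, where `x : U`, then `t` reduces to a term of type
`U → T`. -/
theorem exists_reds_typed_arrow {V : Type u} {A : Type v} {Γ : Ctx V P} {Δ : Ctx A P} {x : V}
    {U T : Ty P} {t s : Term V A} (hx : Γ x = some U) (hs : (t.app (.var x)).Reds s)
    (h : Typed Γ s T Δ) : ∃ t', t.Reds t' ∧ Typed Γ t' (.arrow U T) Δ := by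
  obtain ⟨t', ht, h'⟩ :=
    -- Only the whole term receives `x` at the start; no free name is in `S`, so `Δ` is the same on
    -- both sides.
    (Term.Applied.arg (Term.Applied.refl t (fun _ => false) x fun _ => rfl)).reds hs
  exact ⟨t', ht, h'.typed hx (fun a => by simp) h⟩

theorem Typed.congr {V : Type u} {A : Type v} {Γ : Ctx V P} {Δ : Ctx A P} {t : Term V A}
    {T : Ty P} (h : Typed Γ t T Δ) :
    ∀ {Γ' : Ctx V P} {Δ' : Ctx A P}, (∀ x ∈ t.freeLam, Γ' x = Γ x) →
      (∀ a ∈ t.freeMu, Δ' a = Δ a) → Typed Γ' t T Δ' := by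
  induction h with
  | ax h => intro _ _ hΓ _; exact .ax ((hΓ _ rfl).trans h)
  | arrowIntro _ ih =>
    intro _ _ hΓ hΔ
    refine .arrowIntro (ih ?_ hΔ)
    rintro (_ | y) hy
    · rfl
    · exact hΓ y hy
  | arrowElim _ _ iht ihs =>
    intro _ _ hΓ hΔ
    exact .arrowElim (iht (fun x hx => hΓ x (.inl hx)) fun a ha => hΔ a (.inl ha))
      (ihs (fun x hx => hΓ x (.inr hx)) fun a ha => hΔ a (.inr ha))
  | mu _ ih =>
    intro _ _ hΓ hΔ
    refine .mu (ih hΓ ?_)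
    rintro (_ | y) hy
    · rfl
    · exact hΔ y hy
  | named ha _ ih =>
    intro _ _ hΓ hΔ
    exact .named ((hΔ _ (.inl rfl)).trans ha) (ih hΓ fun a ha => hΔ a (.inr ha))

theorem Typed.declares {V : Type u} {A : Type v} {Γ : Ctx V P} {Δ : Ctx A P} {t : Term V A}
    {T : Ty P} (h : Typed Γ t T Δ) :
    (∀ x ∈ t.freeLam, Γ x ≠ none) ∧ ∀ a ∈ t.freeMu, Δ a ≠ none := by
  induction h with
  | ax h =>
    refine ⟨?_, fun _ ha => ha.elim⟩
    rintro _ rfl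
    simp [h]
  | arrowIntro _ ih => exact ⟨fun x hx => ih.1 (some x) hx, ih.2⟩
  | arrowElim _ _ iht ihs =>
    exact ⟨fun x hx => hx.elim (iht.1 x) (ihs.1 x), fun a ha => ha.elim (iht.2 a) (ihs.2 a)⟩
  | mu _ ih => exact ⟨ih.1, fun a ha => ih.2 (some a) ha⟩
  | named ha _ ih =>
    refine ⟨ih.1, ?_⟩
    rintro a (rfl | h)
    · simp [ha]
    · exact ih.2 a h

end Typing

/-! ### The completeness model -/

namespace Enumerations

variable {V : Type u} {A : Type v} {P : Type w} (E : Enumerations V A P)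

theorem G_lamVar (i : ℕ) : E.G (E.lamVar i) = some (E.lamTy i) :=
  E.lamVar_injective.extend_apply _ _ _

theorem mem_range_lamVar {x : V} (h : E.G x ≠ none) : x ∈ Set.range E.lamVar := by
  by_contra hx
  exact h (Function.extend_apply' _ _ _ hx)

theorem mem_range_muVar {a : A} (h : E.D a ≠ none) : a ∈ Set.range E.muVar := by
  by_contra ha
  exact h (Function.extend_apply' _ _ _ ha)

/-- Typing depends only on the declarations of free variables, and `G` and `D` declare nothing
outside the enumerated variables. -/
theorem types_iff_typed {t : Term V A} {T : Ty P} : E.Types t T ↔ Typed E.G t T E.D := by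
  refine ⟨fun h => h.2.congr ?_ ?_, fun h => ⟨⟨fun x hx => ?_, fun a ha => ?_⟩, h.congr ?_ ?_⟩⟩
  · exact fun x hx => (if_pos hx).symm
  · exact fun a ha => (if_pos ha).symm
  · exact E.mem_range_lamVar (h.declares.1 x hx)
  · exact E.mem_range_muVar (h.declares.2 a ha)
  · exact fun x hx => if_pos hx
  · exact fun a ha => if_pos ha

theorem typesStar_arrow_iff {t : Term V A} {S T : Ty P} :
    E.TypesStar t (.arrow S T) ↔ ∀ s, E.TypesStar s S → E.TypesStar (t.app s) T := by
  simp only [TypesStar, types_iff_typed]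
  constructor
  · rintro ⟨t', ht, h⟩ s ⟨s', hs, h'⟩
    exact ⟨_, ht.app hs, .arrowElim h h'⟩
  · intro h
    obtain ⟨i, rfl⟩ := E.lamTy_surjective S
    -- Since every type occurs among the `A_i`, some `x_i` inhabits the domain; this single argument
    -- suffices.
    obtain ⟨s, hs, h'⟩ := h _ ⟨.var (E.lamVar i), .refl, .ax (E.G_lamVar i)⟩
    exact exists_reds_typed_arrow (E.G_lamVar i) hs h'

end Enumerations

end LambdaMu

theorem mainTheorem3 {V : Type*} {A : Type*} {P : Type*} (E : LambdaMu.Enumerations V A P)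
    (I : P → Set (LambdaMu.Term V A))
    (hI : ∀ (i : ℕ) (p : P), E.atom i = LambdaMu.Ty.var p → I p = E.bottom i)
    (T : LambdaMu.Ty P) (t : LambdaMu.Term V A) :
    E.TypesStar t T ↔ t ∈ LambdaMu.interp (E.bottom 0) I T := by
  induction T generalizing t with
  | var p =>
    have hp : LambdaMu.Ty.var p ∈ Set.range E.atom := by
      rw [E.range_atom]
      exact .inr ⟨p, rfl⟩
    obtain ⟨i, hi⟩ := hp
    rw [LambdaMu.interp, hI i p hi, ← hi]
    rfl
  | bot =>
    rw [← E.atom_zero, E.atom_zero, LambdaMu.interp, LambdaMu.Enumerations.bottom, E.atom_zero]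
    rfl
  | arrow S T ihS ihT =>
    rw [E.typesStar_arrow_iff]
    simp only [ihS, ihT]
    rfl
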